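/- In the generalized poset sorting problem with comparable edges (GPSC), there is an unknown poset $\mathcal P=(V,\prec)$ on $n$ elements and a known undirected graph $G=(V,E)$ such that - every edge of $G$ is comparable: for all $\{u,v\}\in E$, either $u\prec v$ or $v\prec u$; - $G$ determines $\mathcal P$: for all $u,v\in V$, $u\prec v$ if and only if there is a directed path with at least one edge from $u$ to $v$ in the digraph $\vec G=(V,\{(x,y) : \{x,y\}\in E,\ x\prec y\})$. The algorithm is given $G$ only. It may adaptively (and using randomness) query edges $\{u,v\}\in E$; a query returns the relation of $u$ and $v$ in $\mathcal P$. It has to output $\mathcal P$, and its cost is the number of queries. The width $k$ of $\mathcal P$ is the maximum size of an antichain; it is not known to the algorithm. **Theorem.** GPSC can be solved on general query graphs and width-$k$ posets using $\tilde O(nk+n^{1.5})$ queries with high probability. Precisely, there is an integer $d\ge 0$ such that for every real $c>0$ there are a constant $C$ and a randomized query algorithm with the following property: for all $n$ and $k$, every graph $G$ on $n$ vertices and every poset $\mathcal P$ of width $k$ on the same vertices satisfying the two conditions above, with probability at least $1-n^{-c}$ the algorithm outputs $\mathcal P$ and makes at most $C\,f\,(\log f)^d$ queries, where $f=nk+n^{1.5}$.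 -/

import Mathlib

namespace PosetSorting

universe u

/-- The possible replies of the oracle to a query `(u, v)`:
`u ≺ v`, `v ≺ u`, or `u` and `v` are incomparable. -/
inductive Reply : Type
  | below
  | above
  | incomparable

/-- The truthful reply to the query `(u, v)` when the hidden poset is `P`. -/
noncomputable def reply {V : Type u} (P : PartialOrder V) (u v : V) : Reply :=
  open Classical in
  if P.lt u v then Reply.below else if P.lt v u then Reply.above else Reply.incomparable

/-- Randomized adaptive query algorithms (randomized decision trees) for the query graph `G`.
At each step such an algorithm either stops and outputs a poset on the vertices, or queries an
edge of `G` and continues depending on the reply, or draws a uniformly random element of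
`{0, …, m}` and continues depending on it. -/
inductive QueryAlg {V : Type u} (G : SimpleGraph V) : Type u
  | output (Q : PartialOrder V) : QueryAlg G
  | query (u v : V) (h : G.Adj u v) (next : Reply → QueryAlg G) : QueryAlg G
  | sample (m : ℕ) (next : Fin (m + 1) → QueryAlg G) : QueryAlg G

/-- The joint distribution of the output and of the number of queries, when the algorithm is run
against the oracle of the hidden poset `P`. -/
noncomputable def QueryAlg.run {V : Type u} {G : SimpleGraph V} (P : PartialOrder V) :
    QueryAlg G → PMF (PartialOrder V × ℕ)
  | .output Q => PMF.pure (Q, 0)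
  | .query u v _ next => (QueryAlg.run P (next (reply P u v))).map fun r => (r.1, r.2 + 1)
  | .sample m next => (PMF.uniformOfFintype (Fin (m + 1))).bind fun i => QueryAlg.run P (next i)

/-- `k` is the width of `P`, the maximum size of an antichain. -/
def IsWidth {V : Type u} (P : PartialOrder V) (k : ℕ) : Prop :=
  IsGreatest {m : ℕ | ∃ s : Finset V, IsAntichain P.le (s : Set V) ∧ s.card = m} k

/-- The edges of `G` that are comparable in `P`, directed from the smaller to the larger vertex. -/
def directedEdge {V : Type u} (G : SimpleGraph V) (P : PartialOrder V) (u v : V) : Prop :=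
  G.Adj u v ∧ P.lt u v

/-- `P` is the poset induced by its directed query graph: `u ≺ v` if and only if there is a
(nonempty) directed path from `u` to `v`. -/
def IsInducedBy {V : Type u} (P : PartialOrder V) (G : SimpleGraph V) : Prop :=
  ∀ u v : V, P.lt u v ↔ Relation.TransGen (directedEdge G P) u v

/-- Every edge of the query graph is comparable in `P`. -/
def EdgesComparable {V : Type u} (G : SimpleGraph V) (P : PartialOrder V) : Prop :=
  ∀ u v : V, G.Adj u v → P.lt u v ∨ P.lt v u

end PosetSorting

/-!
The algorithm has two phases. The first queries about `n ^ 1.5` random pairs (those that are edges)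
and picks any poset `Q` that satisfies the promises and agrees with the replies. Posets that satisfy
the promises are determined by a function `Fin n → Fin n` (the `rank`), so there are at most
`n ^ n` of them, and a union bound (`card_missing_le`) shows that with high probability `Q`
mispredicts only `O(n ^ 1.5 * log n)` edges.

The second phase recovers `P` from the prediction `Q` with `O(n * k * log n)` queries, not counting
those of mispredicted edges. Call `x` a predicted in-neighbour of `u` if `{x, u}` is an edge and
`x` is below `u` in `Q`. Vertices are *settled* in an order fixed by `G`, `Q` and `P` alone
(`stage`): at each step, settle the vertices `u` whose true in-neighbours, i.e. the predicted
in-neighbours that do lie below `u`, have the smallest width in the order implied by the edges at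
settled vertices. This width is at most `k`, as a `P`-minimal unsettled vertex shows
(`exists_relWidth_trueIn_le`). To settle `u`, its predicted in-neighbours are queried by decreasing
random priority, skipping those already implied to lie below `u`. A query that confirms the
prediction is then a *record*: at some stage, the true in-neighbours `E` of larger priority have
width at most `k`, and `x` is below none of them. Because the stages do not depend on
the priorities and the settled order only grows, at most `k + 1` elements of any set are records
over the rest of it (`card_isRecord_le`), so that the element of the `i`-th largest
priority is a record with probability at most `(k + 1) / i`. An exponential moment bound
(`sum_two_pow_card_records_le`) gives `O(k * log n)` records at each vertex with high probability.

The width `k` and the stages are unknown to the algorithm. Instead of simulating them, it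
makes any query that is `Justified` (mispredicted, or a record) for *all* posets that are consistent
with the replies so far, and `eq_of_forall_not_justified` shows that such a query exists until
a single poset is left. The output is therefore always correct, and the number of queries in the
second phase is at most the number of justified pairs of the hidden poset (`run_greedy`).
-/

namespace PosetSorting

open Finset Relation

/-! ### Admissible posets and the order implied by settled edges -/

section Candidates

variable {V : Type*} {G : SimpleGraph V} {D : V → V → Prop} {P P' : PartialOrder V}

/-- The two promises of the problem: `G` determines `P` and consists of comparable pairs. -/
def Admissible (G : SimpleGraph V) (P : PartialOrder V) : Prop :=
  IsInducedBy P G ∧ EdgesComparable G P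

theorem not_lt_of_lt {x y : V} (h : P.lt x y) : ¬ P.lt y x :=
  @lt_asymm V P.toPreorder x y h

theorem Admissible.not_lt_iff (hP : Admissible G P) {x y : V} (h : G.Adj x y) :
    ¬ P.lt x y ↔ P.lt y x :=
  ⟨fun hn => (hP.2 x y h).resolve_left hn, fun h' => not_lt_of_lt h'⟩

theorem partialOrder_ext_lt (h : ∀ x y, P.lt x y ↔ P'.lt x y) : P = P' := by
  refine PartialOrder.ext fun x y => ?_
  rw [@le_iff_lt_or_eq V P, @le_iff_lt_or_eq V P']
  exact or_congr (h x y) Iff.rfl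

theorem Admissible.ext (hP : Admissible G P) (hP' : Admissible G P')
    (h : ∀ x y, G.Adj x y → (P.lt x y ↔ P'.lt x y)) : P = P' := by
  refine partialOrder_ext_lt fun x y => ?_
  have : directedEdge G P = directedEdge G P' := by
    funext a b
    exact propext (and_congr_right fun hab => h a b hab)
  rw [hP.1 x y, hP'.1 x y, this]

theorem lt_iff_of_reply_eq {x y : V} (h : reply P x y = reply P' x y) :
    P.lt x y ↔ P'.lt x y := by
  unfold reply at h
  split_ifs at h <;> simp_all

/-- The edge `{x, u}` exists and the prediction `D` puts `x` below `u`. -/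
def PredIn (G : SimpleGraph V) (D : V → V → Prop) (x u : V) : Prop :=
  G.Adj x u ∧ D x u

/-- The edges of `P` between a vertex of `A` and one of its predicted in-neighbours. -/
def SettledEdge (G : SimpleGraph V) (D : V → V → Prop) (P : PartialOrder V) (A : Set V)
    (x y : V) : Prop :=
  P.lt x y ∧ ((y ∈ A ∧ PredIn G D x y) ∨ (x ∈ A ∧ PredIn G D y x))

/-- The part of `P` that is implied by the settled edges. -/
def SettledLE (G : SimpleGraph V) (D : V → V → Prop) (P : PartialOrder V) (A : Set V) :
    V → V → Prop :=
  ReflTransGen (SettledEdge G D P A)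

theorem SettledLE.mono {A B : Set V} (hAB : A ⊆ B) {x y : V} (h : SettledLE G D P A x y) :
    SettledLE G D P B x y :=
  ReflTransGen.mono (fun _ _ hab =>
    ⟨hab.1, hab.2.imp (And.imp_left (hAB ·)) (And.imp_left (hAB ·))⟩) _ _ h

theorem SettledLE.le {A : Set V} {x y : V} (h : SettledLE G D P A x y) : P.le x y := by
  induction h with
  | refl => exact P.le_refl x
  | tail _ h ih => exact P.le_trans _ _ _ ih (@le_of_lt V P.toPreorder _ _ h.1)

theorem SettledLE.lt_of_lt {A : Set V} {x y u : V} (h : SettledLE G D P A x y)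
    (hy : P.lt y u) : P.lt x u :=
  @lt_of_le_of_lt V P.toPreorder _ _ _ h.le hy

end Candidates

/-! ### Width of a relation on a finite set -/

section Width

variable {V : Type*}

open Classical in
/-- The largest size of an antichain of the relation `r` inside `Y`. -/
noncomputable def relWidth (r : V → V → Prop) (Y : Finset V) : ℕ :=
  (Y.powerset.filter fun s : Finset V => IsAntichain r (s : Set V)).sup card

theorem relWidth_le {r : V → V → Prop} {Y : Finset V} {k : ℕ} :
    relWidth r Y ≤ k ↔ ∀ s ⊆ Y, IsAntichain r (s : Set V) → s.card ≤ k := by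
  simp [relWidth]

theorem IsAntichain.card_le_relWidth {r : V → V → Prop} {Y s : Finset V} (hs : s ⊆ Y)
    (h : IsAntichain r (s : Set V)) : s.card ≤ relWidth r Y :=
  relWidth_le.1 le_rfl s hs h

theorem relWidth_mono (r : V → V → Prop) {Y Z : Finset V} (h : Y ⊆ Z) :
    relWidth r Y ≤ relWidth r Z :=
  relWidth_le.2 fun _ hs ha => IsAntichain.card_le_relWidth (hs.trans h) ha

end Width

/-! ### The canonical settling order and justified queries -/

section Stages

variable {V : Type*} [Fintype V] {G : SimpleGraph V} {D : V → V → Prop} {P P' : PartialOrder V}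

open Classical in
/-- The predicted in-neighbours of `u` that really lie below `u`. -/
noncomputable def trueIn (G : SimpleGraph V) (D : V → V → Prop) (P : PartialOrder V) (u : V) :
    Finset V :=
  univ.filter fun x => PredIn G D x u ∧ P.lt x u

theorem mem_trueIn {u x : V} : x ∈ trueIn G D P u ↔ PredIn G D x u ∧ P.lt x u := by
  simp [trueIn]

/-- The settled vertices after `t` steps: at each step, all those unsettled vertices become
settled whose true predicted in-neighbours have the smallest width in the order settled so far.
This depends on `G`, the prediction and the hidden poset, but on no random choice. -/
noncomputable def stage (G : SimpleGraph V) (D : V → V → Prop) (P : PartialOrder V) : ℕ → Set V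
  | 0 => ∅
  | t + 1 => stage G D P t ∪ {u | u ∉ stage G D P t ∧ ∀ v ∉ stage G D P t,
      relWidth (SettledLE G D P (stage G D P t)) (trueIn G D P u) ≤
        relWidth (SettledLE G D P (stage G D P t)) (trueIn G D P v)}

theorem stage_mono : Monotone (stage G D P) :=
  monotone_nat_of_le_succ fun _ => Set.subset_union_left

theorem stage_eq_univ_or_ncard_le (t : ℕ) :
    stage G D P t = Set.univ ∨ t ≤ (stage G D P t).ncard := by
  induction t with
  | zero => simp
  | succ t ih =>
    by_cases hu : stage G D P t = Set.univ
    · exact Or.inl (Set.univ_subset_iff.1 (hu ▸ stage_mono t.le_succ))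
    · refine Or.inr ?_
      have ht := ih.resolve_left hu
      obtain ⟨v, hv⟩ := (Set.ne_univ_iff_exists_notMem _).1 hu
      obtain ⟨u, hu, hmin⟩ := Set.exists_min_image (stage G D P t)ᶜ
        (fun u => relWidth (SettledLE G D P (stage G D P t)) (trueIn G D P u))
        (Set.toFinite _) ⟨v, hv⟩
      have hlt : stage G D P t ⊂ stage G D P (t + 1) :=
        (Set.ssubset_iff_of_subset (stage_mono t.le_succ)).2
          ⟨u, Or.inr ⟨hu, fun v hv => hmin v hv⟩, hu⟩
      have := Set.ncard_lt_ncard hlt (Set.toFinite _)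
      omega

theorem exists_stage_eq_univ : ∃ t, stage G D P t = Set.univ := by
  refine ⟨Fintype.card V + 1, (stage_eq_univ_or_ncard_le _).resolve_right fun h => ?_⟩
  have := Set.ncard_le_card (stage G D P (Fintype.card V + 1))
  rw [Nat.card_eq_fintype_card] at this
  omega

/-- Below a minimal unsettled vertex, the settled order is the whole of `P`, so that the width
there is at most the width of `P`. -/
theorem exists_relWidth_trueIn_le (hP : Admissible G P)
    (hD : ∀ x y, G.Adj x y → D x y ∨ D y x) {k : ℕ} (hk : IsWidth P k) {A : Set V}
    (hA : A ≠ Set.univ) :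
    ∃ u ∉ A, relWidth (SettledLE G D P A) (trueIn G D P u) ≤ k := by
  obtain ⟨v, hv⟩ := (Set.ne_univ_iff_exists_notMem _).1 hA
  obtain ⟨u, hu⟩ := @Set.Finite.exists_minimal V P.toPreorder.toLE
    ⟨fun _ _ _ h₁ h₂ => P.le_trans _ _ _ h₂ h₁⟩ Aᶜ (Set.toFinite _) ⟨v, hv⟩
  have hbelow : ∀ y, P.lt y u → y ∈ A := by
    intro y hy
    by_contra hyA
    exact @not_lt_of_ge V P.toPreorder _ _ (hu.2 hyA (@le_of_lt V P.toPreorder _ _ hy)) hy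
  refine ⟨u, hu.1, relWidth_le.2 fun s hs ha => hk.2 ⟨s, ?_, rfl⟩⟩
  intro x hx y hy hxy hle
  refine ha hx hy hxy ?_
  have hyu : P.lt y u := (mem_trueIn.1 (hs hy)).2
  have hlt : P.lt x y := @lt_of_le_of_ne V P _ _ hle hxy
  have hpath := (hP.1 x y).1 hlt
  clear hxy hle hlt hy
  induction hpath with
  | single h =>
    have hxu := @lt_trans V P.toPreorder _ _ _ h.2 hyu
    refine ReflTransGen.single ⟨h.2, ?_⟩
    rcases hD _ _ h.1 with hd | hd
    · exact Or.inl ⟨hbelow _ hyu, h.1, hd⟩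
    · exact Or.inr ⟨hbelow _ hxu, h.1.symm, hd⟩
  | tail _ h ih =>
    have hbu := @lt_trans V P.toPreorder _ _ _ h.2 hyu
    refine ReflTransGen.tail (ih hbu) ⟨h.2, ?_⟩
    rcases hD _ _ h.1 with hd | hd
    · exact Or.inl ⟨hbelow _ hyu, h.1, hd⟩
    · exact Or.inr ⟨hbelow _ hbu, h.1.symm, hd⟩

/-- At some stage, `x` is not below an element of `E`, and `E` is no wider than `P`. -/
def IsRecord (G : SimpleGraph V) (D : V → V → Prop) (P : PartialOrder V) (x : V)
    (E : Finset V) : Prop :=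
  ∃ t, (∀ k, IsWidth P k → relWidth (SettledLE G D P (stage G D P t)) E ≤ k) ∧
    ∀ y ∈ E, ¬ SettledLE G D P (stage G D P t) x y

open Classical in
/-- The queries `(x, u)` that the algorithm may make when the hidden poset is `P`: `x` is predicted
to be below `u`, and either this is wrong, or `x` is a record among the true predicted in-neighbours
of `u` of larger priority `ρ`. -/
def Justified (G : SimpleGraph V) (D : V → V → Prop) (ρ : V → ℕ) (P : PartialOrder V)
    (x u : V) : Prop :=
  PredIn G D x u ∧
    (P.lt x u → IsRecord G D P x ((trueIn G D P u).filter fun y => ρ x < ρ y))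

/-- For `x ∈ F` that are records over `F \ {x}`: they form an antichain at the earliest of the
stages that witness this, and all but one of them lie in a set of width at most `k` there. -/
theorem card_isRecord_le [DecidableEq V] {k : ℕ} (hk : IsWidth P k) (F X : Finset V) (hX : X ⊆ F)
    (h : ∀ x ∈ X, IsRecord G D P x (F.erase x)) : X.card ≤ k + 1 := by
  rcases X.eq_empty_or_nonempty with rfl | hne
  · simp
  choose! t ht using h
  obtain ⟨x₀, hx₀, hmin⟩ := X.exists_min_image t hne
  have hanti : IsAntichain (SettledLE G D P (stage G D P (t x₀))) (X : Set V) := by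
    intro x hx y hy hxy hle
    exact (ht x hx).2 y (mem_erase.2 ⟨hxy.symm, hX hy⟩) (hle.mono (stage_mono (hmin x hx)))
  have hsub : X.erase x₀ ⊆ F.erase x₀ := erase_subset_erase _ hX
  have h1 := (IsAntichain.card_le_relWidth hsub
    (hanti.subset (by simp))).trans ((ht x₀ hx₀).1 k hk)
  have := card_erase_add_one hx₀
  omega

end Stages

/-! ### Existence of a justified query -/

section Progress

variable {V : Type*} [Fintype V] {G : SimpleGraph V} {D : V → V → Prop} {P P' : PartialOrder V}

/-- `x` is a predicted in-neighbour of `u`, and the answers to the queries in `K`, together with the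
settled edges, imply that it lies below `u`. -/
def KnownIn (G : SimpleGraph V) (D : V → V → Prop) (P : PartialOrder V) (A : Set V)
    (K : Set (V × V)) (u x : V) : Prop :=
  PredIn G D x u ∧ ∃ y, PredIn G D y u ∧ (y, u) ∈ K ∧ P.lt y u ∧ SettledLE G D P A x y

open Classical in
/-- The finite set of all `x` with `KnownIn G D P A K u x`. -/
noncomputable def knownIn (G : SimpleGraph V) (D : V → V → Prop) (P : PartialOrder V) (A : Set V)
    (K : Set (V × V)) (u : V) : Finset V :=
  univ.filter (KnownIn G D P A K u)

theorem mem_knownIn {A : Set V} {K : Set (V × V)} {u x : V} :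
    x ∈ knownIn G D P A K u ↔ PredIn G D x u ∧
      ∃ y, PredIn G D y u ∧ (y, u) ∈ K ∧ P.lt y u ∧ SettledLE G D P A x y := by
  simp [knownIn, KnownIn]

theorem knownIn_subset_trueIn {A : Set V} {K : Set (V × V)} {u : V} :
    knownIn G D P A K u ⊆ trueIn G D P u := by
  intro x hx
  obtain ⟨hxu, y, -, -, hyu, hle⟩ := mem_knownIn.1 hx
  exact mem_trueIn.2 ⟨hxu, hle.lt_of_lt hyu⟩

/-- Posets that agree on the edges at the vertices of `A` have the same settled order. -/
theorem settledLE_congr (hP : Admissible G P) (hP' : Admissible G P') {A : Set V}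
    (hR : ∀ u ∈ A, trueIn G D P' u = trueIn G D P u) :
    SettledLE G D P' A = SettledLE G D P A := by
  have key : ∀ u ∈ A, ∀ x, PredIn G D x u → (P'.lt x u ↔ P.lt x u) := by
    intro u hu x hx
    have h : x ∈ trueIn G D P' u ↔ x ∈ trueIn G D P u := by rw [hR u hu]
    simpa [mem_trueIn, hx] using h
  have : SettledEdge G D P' A = SettledEdge G D P A := by
    funext x y
    refine propext (and_congr_left fun h => ?_)
    rcases h with ⟨hy, h⟩ | ⟨hx, h⟩
    · exact key y hy x h
    · rw [← hP.not_lt_iff h.1, ← hP'.not_lt_iff h.1, key x hx y h]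
  unfold SettledLE
  rw [this]

/-- Suppose that the posets `P'` in `C` agree on the queries in `K`, and that no query outside `K`
is justified for all of them. If they have the same settled order at the current stage, then
the vertices settled next are those whose *known* in-neighbours have the smallest width, and for
those vertices every true in-neighbour is known. Otherwise, the undetermined vertex of
the largest priority would give a justified query. -/
theorem trueIn_eq_knownIn (hD : ∀ x y, G.Adj x y → D x y ∨ D y x) {ρ : V → ℕ}
    {C : Set (PartialOrder V)} {K : Set (V × V)} (hC : ∀ P' ∈ C, Admissible G P')
    (hK : ∀ P' ∈ C, ∀ p ∈ K, P'.lt p.1 p.2 ↔ P.lt p.1 p.2)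
    (hno : ∀ x u, PredIn G D x u → (x, u) ∉ K → ∃ P' ∈ C, ¬ Justified G D ρ P' x u)
    {t : ℕ} {A : Set V} (hA : ∀ P' ∈ C, stage G D P' t = A)
    (hQ : ∀ P' ∈ C, SettledLE G D P' A = SettledLE G D P A)
    {u : V} (hu : u ∉ A)
    (hmin : ∀ v ∉ A, relWidth (SettledLE G D P A) (knownIn G D P A K u) ≤
      relWidth (SettledLE G D P A) (knownIn G D P A K v)) :
    ∀ P' ∈ C, trueIn G D P' u = knownIn G D P A K u := by
  classical
  have hknown : ∀ P' ∈ C, ∀ v, knownIn G D P' A K v = knownIn G D P A K v := by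
    intro P' hP' v
    ext x
    rw [mem_knownIn, mem_knownIn, hQ P' hP']
    refine and_congr_right fun _ => exists_congr fun y => and_congr_right fun _ =>
      and_congr_right fun hy => and_congr_left fun _ => hK P' hP' _ hy
  have hdet : ∀ x, PredIn G D x u → (x, u) ∈ K ∨ x ∈ knownIn G D P A K u := by
    by_contra! hcon
    obtain ⟨x₁, hx₁⟩ := hcon
    obtain ⟨x, hx, hmax⟩ := (univ.filter fun x =>
      PredIn G D x u ∧ (x, u) ∉ K ∧ x ∉ knownIn G D P A K u).exists_max_image ρ
      ⟨x₁, by simpa using hx₁⟩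
    simp only [mem_filter, mem_univ, true_and] at hx hmax
    obtain ⟨P', hP', hnot⟩ := hno x u hx.1 hx.2.1
    refine hnot ⟨hx.1, fun _ => ⟨t, ?_⟩⟩
    rw [hA P' hP', hQ P' hP']
    have hsub : ((trueIn G D P' u).filter fun y => ρ x < ρ y) ⊆ knownIn G D P A K u := by
      intro y hy
      obtain ⟨hy, hlt⟩ := mem_filter.1 hy
      obtain ⟨hyu, hylt⟩ := mem_trueIn.1 hy
      by_contra hyk
      by_cases hyK : (y, u) ∈ K
      · exact hyk (mem_knownIn.2 ⟨hyu, y, hyu, hyK, (hK P' hP' _ hyK).1 hylt, .refl⟩)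
      · exact absurd (hmax y ⟨hyu, hyK, hyk⟩) (not_le.2 hlt)
    refine ⟨fun k hk => ?_, fun y hy hle => hx.2.2 ?_⟩
    · obtain ⟨v, hv, hvk⟩ := exists_relWidth_trueIn_le (hC P' hP') hD hk
        ((Set.ne_univ_iff_exists_notMem A).2 ⟨u, hu⟩)
      rw [hQ P' hP'] at hvk
      exact (relWidth_mono _ hsub).trans ((hmin v hv).trans
        ((relWidth_mono _ (hknown P' hP' v ▸ knownIn_subset_trueIn)).trans hvk))
    · obtain ⟨-, z, hz, hzK, hzlt, hyz⟩ := mem_knownIn.1 (hsub hy)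
      exact mem_knownIn.2 ⟨hx.1, z, hz, hzK, hzlt, hle.trans hyz⟩
  intro P' hP'
  refine Subset.antisymm (fun x hx => ?_) (hknown P' hP' u ▸ knownIn_subset_trueIn)
  obtain ⟨hxu, hlt⟩ := mem_trueIn.1 hx
  exact (hdet x hxu).elim
    (fun hxK => mem_knownIn.2 ⟨hxu, x, hxu, hxK, (hK P' hP' _ hxK).1 hlt, .refl⟩) id

/-- As long as the answers to the queries in `K` do not determine the poset, some further query is
justified for every poset that is consistent with them. -/
theorem eq_of_forall_not_justified (hD : ∀ x y, G.Adj x y → D x y ∨ D y x) {ρ : V → ℕ}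
    {C : Set (PartialOrder V)} {K : Set (V × V)} (hC : ∀ P' ∈ C, Admissible G P')
    (hP : P ∈ C) (hK : ∀ P' ∈ C, ∀ p ∈ K, P'.lt p.1 p.2 ↔ P.lt p.1 p.2)
    (hno : ∀ x u, PredIn G D x u → (x, u) ∉ K → ∃ P' ∈ C, ¬ Justified G D ρ P' x u) :
    ∀ P' ∈ C, P' = P := by
  have main : ∀ t, ∀ P' ∈ C, stage G D P' t = stage G D P t ∧
      ∀ u ∈ stage G D P t, trueIn G D P' u = trueIn G D P u := by
    intro t
    induction t with
    | zero => exact fun P' _ => ⟨rfl, fun u hu => hu.elim⟩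
    | succ t ih =>
      set A := stage G D P t
      have hQ : ∀ P' ∈ C, SettledLE G D P' A = SettledLE G D P A := fun P' hP' =>
        settledLE_congr (hC P hP) (hC P' hP') (ih P' hP').2
      set w : V → ℕ := fun v => relWidth (SettledLE G D P A) (knownIn G D P A K v)
      have heq : ∀ u ∉ A, (∀ v ∉ A, w u ≤ w v) →
          ∀ P' ∈ C, trueIn G D P' u = knownIn G D P A K u := fun u hu hmin =>
        trueIn_eq_knownIn hD hC hK hno (fun P' hP' => (ih P' hP').1) hQ hu hmin
      have hle : ∀ P' ∈ C, ∀ v, w v ≤ relWidth (SettledLE G D P A) (trueIn G D P' v) := by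
        intro P' hP' v
        refine relWidth_mono _ fun x hx => ?_
        obtain ⟨hxu, y, -, hyK, hyu, hxy⟩ := mem_knownIn.1 hx
        exact mem_trueIn.2 ⟨hxu, (hQ P' hP' ▸ hxy : SettledLE G D P' A x y).lt_of_lt
          ((hK P' hP' _ hyK).2 hyu)⟩
      -- The next vertices to be settled are the minimisers of `w`, a function that does not
      -- depend on the choice of `P'` in `C`.
      have hnext : ∀ P' ∈ C, ∀ u ∉ A,
          ((∀ v ∉ A, relWidth (SettledLE G D P A) (trueIn G D P' u) ≤
            relWidth (SettledLE G D P A) (trueIn G D P' v)) ↔ ∀ v ∉ A, w u ≤ w v) := by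
        intro P' hP' u hu
        constructor
        · intro h
          obtain ⟨u₀, hu₀, hmin⟩ := Set.exists_min_image Aᶜ w (Set.toFinite _) ⟨u, hu⟩
          have h₀ : relWidth (SettledLE G D P A) (trueIn G D P' u₀) = w u₀ := by
            rw [heq u₀ hu₀ (fun v hv => hmin v hv) P' hP']
          exact fun v hv => (hle P' hP' u).trans ((h u₀ hu₀).trans (h₀ ▸ hmin v hv))
        · intro h v hv
          rw [heq u hu h P' hP']
          exact (h v hv).trans (hle P' hP' v)
      have hset : ∀ P' ∈ C, stage G D P' (t + 1) = A ∪ {u | u ∉ A ∧ ∀ v ∉ A, w u ≤ w v} := by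
        intro P' hP'
        rw [stage, (ih P' hP').1, hQ P' hP']
        congr 1
        ext u
        exact and_congr_right fun hu => hnext P' hP' u hu
      refine fun P' hP' => ⟨(hset P' hP').trans (hset P hP).symm, fun u hu => ?_⟩
      rw [hset P hP] at hu
      rcases hu with hu | ⟨hu, hmin⟩
      · exact (ih P' hP').2 u hu
      · rw [heq u hu hmin P' hP', heq u hu hmin P hP]
  intro P' hP'
  obtain ⟨t, ht⟩ := exists_stage_eq_univ (G := G) (D := D) (P := P)
  have hR : ∀ u x, PredIn G D x u → (P'.lt x u ↔ P.lt x u) := by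
    intro u x hx
    have h : x ∈ trueIn G D P' u ↔ x ∈ trueIn G D P u := by
      rw [(main t P' hP').2 u (ht ▸ Set.mem_univ u)]
    simpa [mem_trueIn, hx] using h
  refine (hC P' hP').ext (hC P hP) fun x y hxy => ?_
  rcases hD x y hxy with h | h
  · exact hR y x ⟨hxy, h⟩
  · rw [← (hC P' hP').not_lt_iff hxy.symm, ← (hC P hP).not_lt_iff hxy.symm, hR x y ⟨hxy.symm, h⟩]

end Progress

/-! ### The algorithm as a decision tree -/

section Algorithm

variable {V : Type*} {G : SimpleGraph V} {D : V → V → Prop} {P : PartialOrder V}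

instance nonempty_partialOrder (α : Type*) : Nonempty (PartialOrder α) :=
  ⟨{ le := Eq
     lt := fun _ _ => False
     lt_iff_le_not_ge := fun _ _ => ⟨False.elim, fun h => h.2 h.1.symm⟩
     le_refl := fun _ => rfl
     le_trans := fun _ _ _ => Eq.trans
     le_antisymm := fun _ _ h _ => h }⟩

/-- A poset in `C`, provided that there is one. -/
@[reducible]
noncomputable def pick (C : Set (PartialOrder V)) : PartialOrder V :=
  Classical.epsilon (· ∈ C)

theorem pick_mem {C : Set (PartialOrder V)} (h : P ∈ C) : pick C ∈ C :=
  Classical.epsilon_spec (p := (· ∈ C)) ⟨P, h⟩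

variable [Fintype V]

open Classical in
/-- The queries that are justified when the hidden poset is `P`. -/
noncomputable def justifiedQueries (G : SimpleGraph V) (D : V → V → Prop) (ρ : V → ℕ)
    (P : PartialOrder V) : Finset (V × V) :=
  univ.filter fun p => Justified G D ρ P p.1 p.2

open Classical in
/-- Keep making new queries that are justified for all posets in the set `C` of candidates.
The first argument bounds the number of queries, `K` is the set of queries made so far. -/
noncomputable def greedy (G : SimpleGraph V) (D : V → V → Prop) (ρ : V → ℕ) :
    ℕ → Set (V × V) → Set (PartialOrder V) → QueryAlg G
  | 0, _, C => .output (pick C)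
  | m + 1, K, C =>
    if h : ∃ p : V × V, PredIn G D p.1 p.2 ∧ p ∉ K ∧ ∀ P' ∈ C, Justified G D ρ P' p.1 p.2 then
      .query h.choose.1 h.choose.2 h.choose_spec.1.1 fun r =>
        greedy G D ρ m (insert h.choose K) {P' ∈ C | reply P' h.choose.1 h.choose.2 = r}
    else .output (pick C)

open Classical in
theorem run_greedy (hD : ∀ x y, G.Adj x y → D x y ∨ D y x) (ρ : V → ℕ) (m : ℕ)
    (K : Set (V × V)) (C : Set (PartialOrder V)) (hC : ∀ P' ∈ C, Admissible G P') (hP : P ∈ C)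
    (hK : ∀ P' ∈ C, ∀ p ∈ K, reply P' p.1 p.2 = reply P p.1 p.2)
    (hm : ((justifiedQueries G D ρ P).filter (· ∉ K)).card ≤ m) :
    ∃ q ≤ ((justifiedQueries G D ρ P).filter (· ∉ K)).card,
      (greedy G D ρ m K C).run P = PMF.pure (P, q) := by
  induction m generalizing K C with
  | zero =>
    refine ⟨0, Nat.zero_le _, ?_⟩
    have hempty := card_eq_zero.1 (Nat.le_zero.1 hm)
    have := eq_of_forall_not_justified hD hC hP
      (fun P' hP' p hp => lt_iff_of_reply_eq (hK P' hP' p hp)) (ρ := ρ) (fun x u _ hxu =>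
        ⟨P, hP, fun hj => by
          have : (x, u) ∈ (justifiedQueries G D ρ P).filter (· ∉ K) := by
            simpa [justifiedQueries] using ⟨hj, hxu⟩
          simp [hempty] at this⟩)
    rw [greedy, QueryAlg.run, this _ (pick_mem hP)]
  | succ m ih =>
    rw [greedy]
    split_ifs with h
    · obtain ⟨-, hpK, hpj⟩ := h.choose_spec
      set p := h.choose
      obtain ⟨K', hK'⟩ : ∃ K', K' = insert p K := ⟨_, rfl⟩
      have hfilter : (justifiedQueries G D ρ P).filter (· ∉ K') =
          ((justifiedQueries G D ρ P).filter (· ∉ K)).erase p := by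
        ext x
        simp only [hK', mem_filter, Set.mem_insert_iff, not_or, mem_erase]
        tauto
      have hmem : p ∈ (justifiedQueries G D ρ P).filter (· ∉ K) := by
        simpa [justifiedQueries] using ⟨hpj P hP, hpK⟩
      have hcard := card_erase_add_one hmem
      obtain ⟨q, hq, hrun⟩ := ih K'
        {P' ∈ C | reply P' p.1 p.2 = reply P p.1 p.2} (fun P' hP' => hC P' hP'.1) ⟨hP, rfl⟩
        (fun P' hP' x hx => by
          rcases hK' ▸ hx with rfl | hx
          · exact hP'.2
          · exact hK P' hP'.1 x hx) (by rw [hfilter]; omega)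
      refine ⟨q + 1, by rw [hfilter] at hq; omega, ?_⟩
      rw [QueryAlg.run, ← hK', hrun, PMF.pure_map]
    · refine ⟨0, Nat.zero_le _, ?_⟩
      push Not at h
      rw [QueryAlg.run, eq_of_forall_not_justified hD hC hP
        (fun P' hP' p hp => lt_iff_of_reply_eq (hK P' hP' p hp)) (ρ := ρ)
        (fun x u hxu hK => h (x, u) hxu hK) _ (pick_mem hP)]

open Classical in
/-- Query those of the given pairs that are edges, then use a poset that is consistent with the
replies as the prediction for `greedy`. The last argument is the set of posets that are consistent
with the replies so far. -/
noncomputable def predictThenGreedy (G : SimpleGraph V) (ρ : V → ℕ) :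
    List (V × V) → Set (PartialOrder V) → QueryAlg G
  | [], C => greedy G (pick C).lt ρ (Fintype.card (V × V)) ∅ {P | Admissible G P}
  | p :: l, C =>
    if h : G.Adj p.1 p.2 then
      .query p.1 p.2 h fun r => predictThenGreedy G ρ l {P' ∈ C | reply P' p.1 p.2 = r}
    else predictThenGreedy G ρ l C

/-- The prediction `Q` does not depend on the priorities `ρ`. -/
theorem run_predictThenGreedy (l : List (V × V)) (C : Set (PartialOrder V))
    (hC : ∀ P' ∈ C, Admissible G P') (hP : P ∈ C) :
    ∃ Q ∈ C, (∀ p ∈ l, G.Adj p.1 p.2 → (Q.lt p.1 p.2 ↔ P.lt p.1 p.2)) ∧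
      ∀ ρ : V → ℕ, ∃ q ≤ l.length + (justifiedQueries G Q.lt ρ P).card,
        (predictThenGreedy G ρ l C).run P = PMF.pure (P, q) := by
  induction l generalizing C with
  | nil =>
    refine ⟨pick C, pick_mem hP, by simp, fun ρ => ?_⟩
    obtain ⟨q, hq, hrun⟩ := run_greedy (P := P) (hC _ (pick_mem hP)).2 ρ (Fintype.card (V × V)) ∅
      {P | Admissible G P} (fun _ h => h) (hC P hP) (by simp) (card_le_univ _)
    exact ⟨q, by simpa using hq, hrun⟩
  | cons p l ih =>
    by_cases h : G.Adj p.1 p.2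
    · obtain ⟨Q, hQ, hl, hrun⟩ := ih {P' ∈ C | reply P' p.1 p.2 = reply P p.1 p.2}
        (fun P' hP' => hC P' hP'.1) ⟨hP, rfl⟩
      refine ⟨Q, hQ.1, ?_, fun ρ => ?_⟩
      · intro x hx hadj
        rcases List.mem_cons.1 hx with rfl | hx
        · exact lt_iff_of_reply_eq hQ.2
        · exact hl x hx hadj
      · obtain ⟨q, hq, hr⟩ := hrun ρ
        refine ⟨q + 1, by rw [List.length_cons]; omega, ?_⟩
        rw [predictThenGreedy, dif_pos h, QueryAlg.run, hr, PMF.pure_map]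
    · obtain ⟨Q, hQ, hl, hrun⟩ := ih C hC hP
      refine ⟨Q, hQ, ?_, fun ρ => ?_⟩
      · intro x hx hadj
        rcases List.mem_cons.1 hx with rfl | hx
        · exact absurd hadj h
        · exact hl x hx hadj
      · obtain ⟨q, hq, hr⟩ := hrun ρ
        refine ⟨q, by rw [List.length_cons]; omega, ?_⟩
        rw [predictThenGreedy, dif_neg h, hr]

end Algorithm

/-! ### Records in a random ordering -/

section Records

variable {V : Type*}

open Classical in
/-- The exponential moment of the number of records of a random ordering. The element at position
`0` is uniformly distributed, independently of the order of the others, and at most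
`K` of its `n + 1` values are records over the set of all the others. -/
theorem sum_two_pow_card_records_le [DecidableEq V] (record : V → Finset V → Prop) (K : ℕ)
    (h : ∀ F : Finset V, (F.filter fun x => record x (F.erase x)).card ≤ K) (n : ℕ)
    (g : Fin n → V) (hg : Function.Injective g) :
    ∑ σ : Equiv.Perm (Fin n),
      2 ^ (univ.filter fun i => record (g (σ i))
        ((univ.filter (i < ·)).image fun j => g (σ j))).card ≤ ∏ i ∈ range n, (i + 1 + K) := by
  induction n with
  | zero => simp
  | succ n ih =>
    set g' : Fin (n + 1) → Fin n → V := fun p j => g (Equiv.swap 0 p j.succ)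
    have hg'inj : ∀ p, Function.Injective (g' p) := fun p =>
      hg.comp ((Equiv.injective _).comp (Fin.succ_injective n))
    have himage : ∀ (p : Fin (n + 1)) (e : Equiv.Perm (Fin n)),
        (univ.filter ((0 : Fin (n + 1)) < ·)).image
          (fun j => g (Equiv.Perm.decomposeFin.symm (p, e) j)) = (univ.image g).erase (g p) := by
      intro p e
      set σ := Equiv.Perm.decomposeFin.symm (p, e)
      have h0 : σ 0 = p := Equiv.Perm.decomposeFin_symm_apply_zero p e
      ext x
      simp only [mem_image, mem_filter, mem_univ, true_and, mem_erase]
      constructor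
      · rintro ⟨j, hj, rfl⟩
        refine ⟨fun heq => hj.ne' (σ.injective ((hg heq).trans h0.symm)), _, rfl⟩
      · rintro ⟨hne, i, rfl⟩
        refine ⟨σ.symm i, Fin.pos_of_ne_zero fun h => hne ?_, by simp⟩
        rw [← h0, ← h, Equiv.apply_symm_apply]
    have hcard : ∀ (p : Fin (n + 1)) (e : Equiv.Perm (Fin n)),
        (univ.filter fun i => record (g (Equiv.Perm.decomposeFin.symm (p, e) i))
          ((univ.filter (i < ·)).image
            fun j => g (Equiv.Perm.decomposeFin.symm (p, e) j))).card =
        (if record (g p) ((univ.image g).erase (g p)) then 1 else 0) +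
          (univ.filter fun i => record (g' p (e i))
            ((univ.filter (i < ·)).image fun j => g' p (e j))).card := by
      intro p e
      rw [card_filter, Fin.sum_univ_succ, card_filter, himage,
        Equiv.Perm.decomposeFin_symm_apply_zero]
      congr 1
      refine sum_congr rfl fun i _ => ?_
      have : (univ.filter (i.succ < ·)).image
          (fun j => g (Equiv.Perm.decomposeFin.symm (p, e) j)) =
          (univ.filter (i < ·)).image fun j => g' p (e j) := by
        ext x
        simp only [mem_image, mem_filter, mem_univ, true_and]
        constructor
        · rintro ⟨j, hj, rfl⟩
          obtain ⟨j, rfl⟩ := Fin.exists_succ_eq.2 ((Fin.succ_pos i).trans hj).ne'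
          exact ⟨j, Fin.succ_lt_succ_iff.1 hj, by
            rw [Equiv.Perm.decomposeFin_symm_apply_succ]⟩
        · rintro ⟨j, hj, rfl⟩
          exact ⟨j.succ, Fin.succ_lt_succ_iff.2 hj, by
            rw [Equiv.Perm.decomposeFin_symm_apply_succ]⟩
      rw [this, Equiv.Perm.decomposeFin_symm_apply_succ]
    rw [← Equiv.sum_comp Equiv.Perm.decomposeFin.symm, Fintype.sum_prod_type, prod_range_succ]
    simp only [hcard, pow_add, ← mul_sum]
    calc _ ≤ ∑ p : Fin (n + 1), 2 ^ (if record (g p) ((univ.image g).erase (g p)) then 1 else 0) *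
          ∏ i ∈ range n, (i + 1 + K) :=
            sum_le_sum fun p _ => Nat.mul_le_mul_left _ (ih (g' p) (hg'inj p))
      _ = (∑ p : Fin (n + 1), (1 + if record (g p) ((univ.image g).erase (g p)) then 1 else 0)) *
          ∏ i ∈ range n, (i + 1 + K) := by
            rw [sum_mul]
            refine sum_congr rfl fun p _ => ?_
            split_ifs <;> rfl
      _ ≤ (n + 1 + K) * ∏ i ∈ range n, (i + 1 + K) := by
            refine Nat.mul_le_mul_right _ ?_
            rw [sum_add_distrib, ← card_filter]
            simp only [sum_const, card_univ, Fintype.card_fin, smul_eq_mul, mul_one]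
            refine Nat.add_le_add_left ((card_le_card_of_injOn g ?_ hg.injOn).trans
              (h (univ.image g))) _
            intro p hp
            simpa using hp
      _ = _ := mul_comm _ _

theorem prod_range_add_le (n K : ℕ) :
    ∏ i ∈ range n, (i + 1 + K) ≤ n.factorial * (n + 1) ^ K := by
  induction n with
  | zero => simp
  | succ n ih =>
    have hbern : (n + 1 + K) * (n + 1) ^ K ≤ (n + 1) * (n + 1 + 1) ^ K := by
      have hpos : (0 : ℚ) < n + 1 := by positivity
      have h := one_add_mul_le_pow (a := 1 / ((n : ℚ) + 1)) (by
        have : 0 ≤ 1 / ((n : ℚ) + 1) := by positivity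
        linarith) K
      have h1 : (1 + 1 / ((n : ℚ) + 1)) ^ K = (n + 1 + 1) ^ K / (n + 1) ^ K := by
        rw [← div_pow]
        congr 1
        field_simp
      rw [h1, le_div_iff₀ (by positivity)] at h
      have h2 := mul_le_mul_of_nonneg_left h hpos.le
      have h3 : ((n : ℚ) + 1) * ((1 + K * (1 / ((n : ℚ) + 1))) * (n + 1) ^ K) =
          (n + 1 + K) * (n + 1) ^ K := by
        field_simp
      rw [h3] at h2
      exact_mod_cast h2
    rw [prod_range_succ, Nat.factorial_succ]
    calc _ ≤ n.factorial * (n + 1) ^ K * (n + 1 + K) := Nat.mul_le_mul_right _ ih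
      _ = n.factorial * ((n + 1 + K) * (n + 1) ^ K) := by ring
      _ ≤ n.factorial * ((n + 1) * (n + 1 + 1) ^ K) := Nat.mul_le_mul_left _ hbern
      _ = _ := by ring

open Classical in
/-- The number of permutations with more than `a` records. -/
theorem card_perm_records_mul_le {n : ℕ} (record : Fin n → Finset (Fin n) → Prop) (K : ℕ)
    (h : ∀ F : Finset (Fin n), (F.filter fun x => record x (F.erase x)).card ≤ K) (a : ℝ) :
    ((univ.filter fun σ : Equiv.Perm (Fin n) =>
      a < (univ.filter fun x => record x (univ.filter fun y => (σ x : ℕ) < σ y)).card).card : ℝ) *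
        2 ^ a ≤ n.factorial * ((n : ℝ) + 1) ^ K := by
  set N : Equiv.Perm (Fin n) → ℕ := fun σ =>
    (univ.filter fun x => record x (univ.filter fun y => (σ x : ℕ) < σ y)).card
  have hsum : ∑ σ, 2 ^ N σ ≤ n.factorial * (n + 1) ^ K := by
    refine le_trans (le_of_eq ?_) ((sum_two_pow_card_records_le record K h n id
      Function.injective_id).trans (prod_range_add_le n K))
    rw [← Equiv.sum_comp (Equiv.inv (Equiv.Perm (Fin n)))]
    refine sum_congr rfl fun σ _ => congrArg _ ?_
    refine card_bij' (fun x _ => σ⁻¹ x) (fun i _ => σ i) ?_ ?_ (by simp) (by simp)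
    · intro x hx
      simp only [Equiv.inv_apply, mem_filter, mem_univ, true_and, id] at hx ⊢
      convert hx using 1
      · simp
      · ext y
        simp only [mem_image, mem_filter, mem_univ, true_and]
        exact ⟨by rintro ⟨j, hj, rfl⟩; simpa using hj, fun hy => ⟨σ⁻¹ y, hy, by simp⟩⟩
    · intro x hx
      simp only [Equiv.inv_apply, mem_filter, mem_univ, true_and, id] at hx ⊢
      convert hx using 1
      ext y
      simp only [mem_image, mem_filter, mem_univ, true_and]
      exact ⟨fun hy => ⟨σ⁻¹ y, by simpa using hy, by simp⟩, by rintro ⟨j, hj, rfl⟩; simpa using hj⟩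
  calc _ = ∑ σ ∈ univ.filter (fun σ => a < N σ), (2 : ℝ) ^ a := by
        rw [sum_const, nsmul_eq_mul]
    _ ≤ ∑ σ ∈ univ.filter (fun σ => a < N σ), (2 : ℝ) ^ N σ := by
        refine sum_le_sum fun σ hσ => ?_
        rw [← Real.rpow_natCast]
        exact Real.rpow_le_rpow_of_exponent_le one_le_two (mem_filter.1 hσ).2.le
    _ ≤ ∑ σ, (2 : ℝ) ^ N σ :=
        sum_le_sum_of_subset_of_nonneg (filter_subset _ _) fun _ _ _ => by positivity
    _ ≤ _ := by exact_mod_cast hsum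

end Records

/-! ### Random samples -/

section Sampling

open Classical in
/-- The outcomes of `N` random samples that miss some set `B f` of more than `W` elements. -/
noncomputable def missing {α ι : Type*} [Fintype α] (B : ι → Finset α) (N : ℕ) (W : ℝ) :
    Finset (Fin N → α) :=
  univ.filter fun l => ∃ f, W < (B f).card ∧ ∀ i, l i ∉ B f

theorem mem_missing {α ι : Type*} [Fintype α] {B : ι → Finset α} {N : ℕ} {W : ℝ}
    {l : Fin N → α} : l ∈ missing B N W ↔ ∃ f, W < (B f).card ∧ ∀ i, l i ∉ B f := by
  simp [missing]

/-- Union bound: a set of more than `W` elements is missed with probability at most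
`(1 - W / card α) ^ N ≤ exp (-N * W / card α)`. -/
theorem card_missing_le {α ι : Type*} [Fintype α] [Nonempty α] [Fintype ι]
    (B : ι → Finset α) (N : ℕ) (W : ℝ) :
    ((missing B N W).card : ℝ) ≤
      Fintype.card ι * (Fintype.card α ^ N * Real.exp (-(N * W / Fintype.card α))) := by
  classical
  have hα : (0 : ℝ) < Fintype.card α := by exact_mod_cast Fintype.card_pos
  have hsub : missing B N W ⊆
      (univ.filter fun f => W < (B f).card).biUnion
        fun f => Fintype.piFinset fun _ : Fin N => (B f)ᶜ := by
    intro l hl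
    obtain ⟨f, hf, hl⟩ := mem_missing.1 hl
    simp only [mem_biUnion, mem_filter, mem_univ, true_and, Fintype.mem_piFinset, mem_compl]
    exact ⟨f, hf, hl⟩
  have hone : ∀ f ∈ univ.filter (fun f => W < (B f).card),
      ((Fintype.piFinset fun _ : Fin N => (B f)ᶜ).card : ℝ) ≤
        Fintype.card α ^ N * Real.exp (-(N * W / Fintype.card α)) := by
    intro f hf
    have hW := (mem_filter.1 hf).2
    rw [Fintype.card_piFinset, prod_const, card_univ, Fintype.card_fin, card_compl,
      Nat.cast_pow, Nat.cast_sub (card_le_univ _)]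
    have hexp : (Fintype.card α : ℝ) - (B f).card ≤
        Fintype.card α * Real.exp (-(W / Fintype.card α)) := by
      have h1 := Real.add_one_le_exp (-(W / Fintype.card α))
      have h2 := mul_le_mul_of_nonneg_left h1 hα.le
      have h3 : (Fintype.card α : ℝ) * (-(W / Fintype.card α) + 1) = Fintype.card α - W := by
        field_simp
        ring
      linarith
    have h0 : (0 : ℝ) ≤ (Fintype.card α : ℝ) - (B f).card :=
      sub_nonneg.2 (by exact_mod_cast card_le_univ _)
    refine (pow_le_pow_left₀ h0 hexp N).trans (le_of_eq ?_)
    rw [mul_pow, ← Real.exp_nat_mul]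
    congr 2
    ring
  calc _ ≤ (((univ.filter fun f => W < (B f).card).biUnion
        fun f => Fintype.piFinset fun _ : Fin N => (B f)ᶜ).card : ℝ) := by
          exact_mod_cast card_le_card hsub
    _ ≤ ∑ f ∈ univ.filter (fun f => W < (B f).card),
        ((Fintype.piFinset fun _ : Fin N => (B f)ᶜ).card : ℝ) := by
          exact_mod_cast card_biUnion_le
    _ ≤ _ := by
          refine (sum_le_card_nsmul _ _ _ hone).trans ?_
          rw [nsmul_eq_mul]
          refine mul_le_mul_of_nonneg_right ?_ (by positivity)
          exact_mod_cast card_le_univ _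

/-- Draw a uniformly random element of `Ω` and continue depending on it. -/
noncomputable def sampleFrom {V : Type*} {G : SimpleGraph V} (Ω : Type*) [Fintype Ω] [Nonempty Ω]
    (f : Ω → QueryAlg G) : QueryAlg G :=
  .sample (Fintype.card Ω - 1) fun i =>
    f ((Fintype.equivFinOfCardEq (Nat.sub_add_cancel Fintype.card_pos).symm).symm i)

/-- An algorithm that behaves deterministically after its random draw succeeds with the probability
that the draw is not bad. -/
theorem le_toOuterMeasure_run_sampleFrom {V : Type*} {G : SimpleGraph V} {P : PartialOrder V}
    {Ω : Type*} [Fintype Ω] [Nonempty Ω] (f : Ω → QueryAlg G) (T : Set (PartialOrder V × ℕ))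
    (bad : Finset Ω) (hT : ∀ ω ∉ bad, ∃ r ∈ T, (f ω).run P = PMF.pure r) {ε : ℝ}
    (hbad : (bad.card : ℝ) ≤ ε * Fintype.card Ω) :
    1 - ENNReal.ofReal ε ≤ ((sampleFrom Ω f).run P).toOuterMeasure T := by
  classical
  set e := (Fintype.equivFinOfCardEq (Nat.sub_add_cancel (Fintype.card_pos (α := Ω))).symm).symm
   
  have hΩ : (0 : ℝ) < Fintype.card Ω := by exact_mod_cast Fintype.card_pos
  have hΩ0 : (Fintype.card Ω : ENNReal) ≠ 0 := by exact_mod_cast Fintype.card_ne_zero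
  have hrun : ((sampleFrom Ω f).run P).toOuterMeasure T =
      ∑ ω : Ω, (Fintype.card Ω : ENNReal)⁻¹ * ((f ω).run P).toOuterMeasure T := by
    rw [sampleFrom, QueryAlg.run, PMF.toOuterMeasure_bind_apply, tsum_fintype, ← e.sum_comp]
    refine sum_congr rfl fun i _ => ?_
    rw [PMF.uniformOfFintype_apply, Fintype.card_fin]
    exact congrArg (fun m : ℕ => (m : ENNReal)⁻¹ * ((f (e i)).run P).toOuterMeasure T)
      (Nat.sub_add_cancel Fintype.card_pos)
  have hε : (bad.card : ENNReal) * (Fintype.card Ω : ENNReal)⁻¹ ≤ ENNReal.ofReal ε := by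
    rw [← div_eq_mul_inv, ENNReal.div_le_iff hΩ0 (ENNReal.natCast_ne_top _),
      ← ENNReal.ofReal_natCast, ← ENNReal.ofReal_natCast, ← ENNReal.ofReal_mul' hΩ.le]
    exact ENNReal.ofReal_le_ofReal hbad
  rw [tsub_le_iff_right, hrun]
  calc (1 : ENNReal) = ∑ ω : Ω, (Fintype.card Ω : ENNReal)⁻¹ := by
        rw [sum_const, card_univ, nsmul_eq_mul,
          ENNReal.mul_inv_cancel hΩ0 (ENNReal.natCast_ne_top _)]
    _ = ∑ ω ∈ badᶜ, (Fintype.card Ω : ENNReal)⁻¹ + ∑ ω ∈ bad, (Fintype.card Ω : ENNReal)⁻¹ :=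
        (sum_compl_add_sum bad _).symm
    _ ≤ _ := by
        refine add_le_add ?_ ((by rw [sum_const, nsmul_eq_mul] : _ = _).trans_le hε)
        refine le_trans (sum_le_sum fun ω hω => ?_)
          (sum_le_sum_of_subset (subset_univ badᶜ))
        obtain ⟨r, hr, hfr⟩ := hT ω (mem_compl.1 hω)
        rw [hfr, PMF.toOuterMeasure_pure_apply, if_pos hr, mul_one]

end Sampling

/-! ### Counting justified queries -/

section Bounds

variable {n : ℕ} {G : SimpleGraph (Fin n)} {P Q : PartialOrder (Fin n)}

open Classical in
/-- The number of elements below `u`. Ranks are compared as natural numbers throughout, because on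
`Fin n` the symbol `<` could refer to a partial order in the context, such as `P`. -/
noncomputable def rank (P : PartialOrder (Fin n)) (u : Fin n) : Fin n :=
  ⟨(univ.filter fun x => P.lt x u).card, by
    have h : (univ.filter fun x => P.lt x u) ⊂ univ :=
      (ssubset_iff_of_subset (subset_univ _)).2
        ⟨u, mem_univ u, by simp⟩
    simpa using card_lt_card h⟩

theorem rank_lt_rank {x y : Fin n} (h : P.lt x y) : (rank P x : ℕ) < rank P y := by
  classical
  have hss : (univ.filter fun z => P.lt z x) ⊂ univ.filter fun z => P.lt z y := by
    refine (ssubset_iff_of_subset fun z hz => ?_).2 ⟨x, mem_filter.2 ⟨mem_univ x, h⟩, by simp⟩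
    exact mem_filter.2 ⟨mem_univ z, @lt_trans _ P.toPreorder _ _ _ (mem_filter.1 hz).2 h⟩
  exact card_lt_card hss

theorem Admissible.lt_iff_rank (hQ : Admissible G Q) {x y : Fin n} (h : G.Adj x y) :
    Q.lt x y ↔ (rank Q x : ℕ) < rank Q y :=
  ⟨rank_lt_rank, fun hr => (hQ.2 x y h).resolve_right fun h' =>
    Nat.lt_asymm hr (rank_lt_rank h')⟩

open Classical in
/-- The edges, as ordered pairs `(x, u)`, on which the direction given by `f` differs from that in `P`. -/
noncomputable def misoriented (G : SimpleGraph (Fin n)) (P : PartialOrder (Fin n))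
    (f : Fin n → Fin n) : Finset (Fin n × Fin n) :=
  univ.filter fun p => G.Adj p.1 p.2 ∧ ¬ ((f p.1 : ℕ) < f p.2 ↔ P.lt p.1 p.2)

open Classical in
/-- `x` is a true predicted in-neighbour of `u` and a record among those of them that are in `E`. -/
def IsRecordAt (G : SimpleGraph (Fin n)) (D : Fin n → Fin n → Prop) (P : PartialOrder (Fin n))
    (u x : Fin n) (E : Finset (Fin n)) : Prop :=
  x ∈ trueIn G D P u ∧ IsRecord G D P x (E.filter (· ∈ trueIn G D P u))

open Classical in
theorem card_isRecordAt_le {D : Fin n → Fin n → Prop} {k : ℕ} (hk : IsWidth P k) (u : Fin n)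
    (F : Finset (Fin n)) :
    (F.filter fun x => IsRecordAt G D P u x (F.erase x)).card ≤ k + 1 := by
  refine card_isRecord_le (G := G) (D := D) hk (F.filter (· ∈ trueIn G D P u)) _ ?_ ?_
  · intro x hx
    obtain ⟨hxF, hx, -⟩ := mem_filter.1 hx
    exact mem_filter.2 ⟨hxF, hx⟩
  · intro x hx
    rw [← filter_erase]
    exact (mem_filter.1 hx).2.2

open Classical in
/-- A justified query is mispredicted or a record. -/
theorem card_justifiedQueries_le (σ : Equiv.Perm (Fin n)) :
    (justifiedQueries G Q.lt (fun x => (σ x : ℕ)) P).card ≤ (misoriented G P (rank Q)).card +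
      ∑ u, (univ.filter fun x =>
        IsRecordAt G Q.lt P u x (univ.filter fun y => (σ x : ℕ) < σ y)).card := by
  have hsub : justifiedQueries G Q.lt (fun x => (σ x : ℕ)) P ⊆ misoriented G P (rank Q) ∪
      univ.biUnion fun u => (univ.filter fun x =>
        IsRecordAt G Q.lt P u x (univ.filter fun y => (σ x : ℕ) < σ y)).image fun x => (x, u) := by
    rintro ⟨x, u⟩ hp
    obtain ⟨hxu, hrec⟩ := (mem_filter.1 hp).2
    by_cases hlt : P.lt x u
    · refine mem_union_right _ (mem_biUnion.2 ⟨u, mem_univ u, mem_image.2 ⟨x, ?_, rfl⟩⟩)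
      refine mem_filter.2 ⟨mem_univ x, mem_trueIn.2 ⟨hxu, hlt⟩, ?_⟩
      convert hrec hlt using 1
      ext y
      simp [and_comm]
    · refine mem_union_left _ (mem_filter.2 ⟨mem_univ _, hxu.1, fun h => hlt (h.1 ?_)⟩)
      exact rank_lt_rank hxu.2
  refine (card_le_card hsub).trans ((card_union_le _ _).trans (Nat.add_le_add_left ?_ _))
  exact card_biUnion_le.trans (sum_le_sum fun u _ => card_image_le)

end Bounds

/-! ### Choice of the parameters -/

section Parameters

variable {n : ℕ} {c : ℝ}

/-- The number of sampled pairs. -/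
noncomputable def sampleSize (n : ℕ) : ℕ := ⌈(n : ℝ) ^ (3 / 2 : ℝ)⌉₊

/-- With high probability, at most this many edges are mispredicted. It is chosen such that
`sampleSize n * errorBound n c / n ^ 2` is at least `(n + c + 1) * log n`, where `n * log n` pays
for the union bound over `n ^ n` candidates. -/
noncomputable def errorBound (n : ℕ) (c : ℝ) : ℝ :=
  (n : ℝ) ^ (1 / 2 : ℝ) * (n + c + 1) * Real.log n

/-- With high probability, every vertex has at most this many records. It is chosen such that
`2 ^ recordBound n k c = n ^ ((k + 1) * (c + 4))`; here `2 * (k + 1)` of the exponent pays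
for the factor `(n + 1) ^ (k + 1)` in the exponential moment, and `c + 2` for the union bound over
the vertices and the probability of failure. -/
noncomputable def recordBound (n k : ℕ) (c : ℝ) : ℝ :=
  (k + 1) * (c + 4) * (Real.log n / Real.log 2)

theorem sampling_failure_le (hn : 2 ≤ n) (hc : 0 < c) :
    (n : ℝ) ^ n * Real.exp (-(sampleSize n * errorBound n c / (n * n : ℝ))) ≤
      (n : ℝ) ^ (-(c + 1)) := by
  have hn0 : (0 : ℝ) < n := by positivity
  have hn1 : (1 : ℝ) ≤ n := by exact_mod_cast (by omega : 1 ≤ n)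
  have hlog : 0 ≤ Real.log n := Real.log_nonneg hn1
  have hprod : (n : ℝ) ^ (3 / 2 : ℝ) * (n : ℝ) ^ (1 / 2 : ℝ) = n * n := by
    rw [← Real.rpow_add hn0, ← sq, ← Real.rpow_natCast]
    norm_num
  have h1 : (n + c + 1) * Real.log n ≤ sampleSize n * errorBound n c / (n * n : ℝ) := by
    rw [le_div_iff₀ (by positivity), ← hprod, errorBound]
    calc _ = (n : ℝ) ^ (3 / 2 : ℝ) * ((n : ℝ) ^ (1 / 2 : ℝ) * (n + c + 1) * Real.log n) := by ring
      _ ≤ _ := mul_le_mul_of_nonneg_right (Nat.le_ceil _) (by positivity)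
  rw [← Real.rpow_natCast, Real.rpow_def_of_pos hn0, Real.rpow_def_of_pos hn0, ← Real.exp_add]
  refine Real.exp_le_exp.2 ?_
  nlinarith

theorem record_failure_le (hn : 2 ≤ n) (hc : 0 < c) (k : ℕ) :
    n * ((n : ℝ) + 1) ^ (k + 1) ≤ (n : ℝ) ^ (-(c + 1)) * 2 ^ recordBound n k c := by
  have hn0 : (0 : ℝ) < n := by positivity
  have hn2 : (2 : ℝ) ≤ n := by exact_mod_cast hn
  have h2 : (2 : ℝ) ^ recordBound n k c = (n : ℝ) ^ (((k : ℝ) + 1) * (c + 4)) := by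
    rw [Real.rpow_def_of_pos two_pos, Real.rpow_def_of_pos hn0, recordBound]
    congr 1
    have := (Real.log_pos one_lt_two).ne'
    field_simp
  have h3 : ((n : ℝ) + 1) ^ (k + 1) ≤ (n : ℝ) ^ ((2 : ℝ) * (k + 1)) := by
    have : (n : ℝ) + 1 ≤ (n : ℝ) ^ 2 := by nlinarith
    refine (pow_le_pow_left₀ (by positivity) this _).trans (le_of_eq ?_)
    rw [← pow_mul, ← Real.rpow_natCast]
    push_cast
    rfl
  rw [h2, ← Real.rpow_add hn0]
  calc _ ≤ (n : ℝ) ^ (1 : ℝ) * (n : ℝ) ^ ((2 : ℝ) * (k + 1)) := by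
        rw [Real.rpow_one]
        exact mul_le_mul_of_nonneg_left h3 hn0.le
    _ = (n : ℝ) ^ (1 + (2 : ℝ) * (k + 1)) := (Real.rpow_add hn0 _ _).symm
    _ ≤ _ := by
        refine Real.rpow_le_rpow_of_exponent_le (by linarith) ?_
        have : (0 : ℝ) ≤ k := k.cast_nonneg
        nlinarith

theorem two_mul_rpow_le (hn : 2 ≤ n) :
    (n : ℝ) ^ (-(c + 1)) + (n : ℝ) ^ (-(c + 1)) ≤ (n : ℝ) ^ (-c) := by
  have hn0 : (0 : ℝ) < n := by positivity
  have hn2 : (2 : ℝ) ≤ n := by exact_mod_cast hn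
  have : (n : ℝ) ^ (-c) = n * (n : ℝ) ^ (-(c + 1)) := by
    rw [mul_comm, ← Real.rpow_add_one hn0.ne']
    congr 1
    ring
  rw [this]
  have := Real.rpow_nonneg hn0.le (-(c + 1))
  nlinarith

theorem query_bound_le (hn : 2 ≤ n) (hc : 0 < c) (k : ℕ) :
    sampleSize n + (errorBound n c + n * recordBound n k c) ≤
      (12 + 3 * c) * ((n : ℝ) * k + (n : ℝ) ^ (3 / 2 : ℝ)) *
        Real.log ((n : ℝ) * k + (n : ℝ) ^ (3 / 2 : ℝ)) ^ 1 := by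
  have hn0 : (0 : ℝ) < n := by positivity
  have hn2 : (2 : ℝ) ≤ n := by exact_mod_cast hn
  have hk : (0 : ℝ) ≤ k := k.cast_nonneg
  set s : ℝ := (n : ℝ) ^ (3 / 2 : ℝ) with hs
  set f : ℝ := (n : ℝ) * k + s with hf
  have hns : (n : ℝ) ≤ s := by
    calc (n : ℝ) = (n : ℝ) ^ (1 : ℝ) := (Real.rpow_one _).symm
      _ ≤ s := Real.rpow_le_rpow_of_exponent_le (by linarith) (by norm_num)
  have hnk : 0 ≤ (n : ℝ) * k := by positivity
  have hlogs : Real.log s = 3 / 2 * Real.log n := Real.log_rpow hn0 _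
  have hlog2 : (0.6931471803 : ℝ) < Real.log 2 := Real.log_two_gt_d9
  have hlogn : Real.log 2 ≤ Real.log n := Real.log_le_log two_pos hn2
  have hlogf : Real.log s ≤ Real.log f := Real.log_le_log (by linarith) (by linarith)
  set l : ℝ := Real.log f with hl
  -- `l ≥ 3 / 2 * log 2 > 1`, so that the terms without a logarithm are absorbed.
  have hl1 : 1 ≤ l := by linarith
  have hln : Real.log n ≤ l := by linarith
  have hsample : (sampleSize n : ℝ) ≤ 2 * s := by
    have := (Nat.ceil_lt_add_one (by linarith : 0 ≤ s)).le
    have h : (sampleSize n : ℝ) = (⌈s⌉₊ : ℝ) := rfl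
    linarith
  have hroot : (n : ℝ) ^ (1 / 2 : ℝ) * n = s := by
    rw [hs, ← Real.rpow_add_one hn0.ne']
    norm_num
  have hroot1 : (n : ℝ) ^ (1 / 2 : ℝ) ≤ s := by
    rw [hs]
    exact Real.rpow_le_rpow_of_exponent_le (by linarith) (by norm_num)
  have herr : errorBound n c ≤ (c + 2) * s * l := by
    have h : (n : ℝ) ^ (1 / 2 : ℝ) * (n + c + 1) ≤ (c + 2) * s := by
      nlinarith
    exact mul_le_mul h hln (by linarith) (by positivity)
  have hrec : (n : ℝ) * recordBound n k c ≤ (f + f) / 2 * (2 * (c + 4)) * l := by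
    have h1 : Real.log n / Real.log 2 ≤ 2 * l := by
      rw [div_le_iff₀ (by linarith)]
      nlinarith
    have h2 : (n : ℝ) * ((k + 1) * (c + 4)) ≤ f * (c + 4) := by nlinarith
    calc (n : ℝ) * recordBound n k c = n * ((k + 1) * (c + 4)) * (Real.log n / Real.log 2) := by
          rw [recordBound]; ring
      _ ≤ f * (c + 4) * (2 * l) := mul_le_mul h2 h1 (by
            refine div_nonneg ?_ ?_ <;> linarith) (by positivity)
      _ = _ := by ring
  have hsl : s ≤ f * l := by nlinarith
  have h4 : (c + 2) * s * l ≤ (c + 2) * f * l := by gcongr; linarith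
  rw [pow_one]
  nlinarith

end Parameters

/-! ### The query bound with high probability -/

section Main

variable {n : ℕ} {G : SimpleGraph (Fin n)} {P : PartialOrder (Fin n)}

/-- Draw random pairs and random priorities, and run `predictThenGreedy` with them. -/
noncomputable def sortingAlg (n : ℕ) (hn : n ≠ 0) (G : SimpleGraph (Fin n)) : QueryAlg G :=
  haveI : NeZero n := ⟨hn⟩
  sampleFrom ((Fin (sampleSize n) → Fin n × Fin n) × Equiv.Perm (Fin n)) fun ω =>
    predictThenGreedy G (fun x => (ω.2 x : ℕ)) (List.ofFn ω.1) {P | Admissible G P}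

open Classical in
theorem le_run_sortingAlg (hn : 2 ≤ n) {c : ℝ} (hc : 0 < c) {k : ℕ} (hk : IsWidth P k)
    (hP : Admissible G P) :
    1 - ENNReal.ofReal ((n : ℝ) ^ (-c)) ≤
      ((sortingAlg n (by omega) G).run P).toOuterMeasure
        {r | r.1 = P ∧ (r.2 : ℝ) ≤ sampleSize n + (errorBound n c + n * recordBound n k c)} := by
  have : NeZero n := ⟨by omega⟩
  have hn0 : (0 : ℝ) < n := by positivity
  choose Q hQ hagree hrun using fun l : Fin (sampleSize n) → Fin n × Fin n =>
    run_predictThenGreedy (P := P) (List.ofFn l) {P | Admissible G P} (fun _ h => h) hP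
  set bad₁ : Finset (Fin (sampleSize n) → Fin n × Fin n) :=
    missing (misoriented G P) (sampleSize n) (errorBound n c)
  set cnt : PartialOrder (Fin n) → Fin n → Equiv.Perm (Fin n) → ℕ := fun Q u σ =>
    (univ.filter fun x => IsRecordAt G Q.lt P u x
      (univ.filter fun y => (σ x : ℕ) < σ y)).card
  set bad₂ : PartialOrder (Fin n) → Finset (Equiv.Perm (Fin n)) := fun Q =>
    univ.biUnion fun u => univ.filter fun σ => recordBound n k c < cnt Q u σ
  have hcard₁ : (bad₁.card : ℝ) ≤
      (n : ℝ) ^ (-(c + 1)) * Fintype.card (Fin (sampleSize n) → Fin n × Fin n) := by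
    refine (card_missing_le (misoriented G P) (sampleSize n) (errorBound n c)).trans ?_
    have := mul_le_mul_of_nonneg_right (sampling_failure_le hn hc)
      (by positivity : (0 : ℝ) ≤ (n * n : ℝ) ^ sampleSize n)
    simp only [Fintype.card_pi, Fintype.card_prod, Fintype.card_fin, prod_const, card_univ,
      Nat.cast_pow, Nat.cast_mul]
    refine le_trans (le_of_eq ?_) this
    ring
  have hcard₂ : ∀ Q, ((bad₂ Q).card : ℝ) ≤
      (n : ℝ) ^ (-(c + 1)) * Fintype.card (Equiv.Perm (Fin n)) := by
    intro Q
    have hpow : (0 : ℝ) < 2 ^ recordBound n k c := Real.rpow_pos_of_pos two_pos _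
    have h1 : ∀ u, ((univ.filter fun σ => recordBound n k c < cnt Q u σ).card : ℝ) ≤
        n.factorial * ((n : ℝ) + 1) ^ (k + 1) / 2 ^ recordBound n k c := by
      intro u
      rw [le_div_iff₀ hpow]
      refine card_perm_records_mul_le (IsRecordAt G Q.lt P u) (k + 1) (fun F => ?_) _
      convert card_isRecordAt_le (D := Q.lt) hk u F
    have h2 : ((bad₂ Q).card : ℝ) ≤
        ∑ u : Fin n, ((univ.filter fun σ => recordBound n k c < cnt Q u σ).card : ℝ) := by
      exact_mod_cast card_biUnion_le
    refine h2.trans ((sum_le_card_nsmul _ _ _ fun u _ => h1 u).trans ?_)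
    rw [card_univ, Fintype.card_fin, nsmul_eq_mul, Fintype.card_perm, Fintype.card_fin,
      ← mul_div_assoc, div_le_iff₀ hpow]
    have := mul_le_mul_of_nonneg_left (record_failure_le hn hc k)
      (n.factorial.cast_nonneg : (0 : ℝ) ≤ n.factorial)
    linarith
  refine le_toOuterMeasure_run_sampleFrom _ _
    (bad₁ ×ˢ univ ∪ univ.filter fun ω => ω.2 ∈ bad₂ (Q ω.1)) ?_ ?_
  · rintro ⟨l, σ⟩ hω
    simp only [mem_union, mem_product, mem_univ, and_true, mem_filter, true_and, not_or] at hω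
    obtain ⟨hl, hσ⟩ := hω
    obtain ⟨q, hq, hr⟩ := hrun l fun x => (σ x : ℕ)
    refine ⟨(P, q), ⟨rfl, ?_⟩, hr⟩
    have hmis : ((misoriented G P (rank (Q l))).card : ℝ) ≤ errorBound n c := by
      by_contra! hlt
      refine hl (mem_missing.2 ⟨_, hlt, fun i hi => ?_⟩)
      obtain ⟨hadj, hne⟩ := (mem_filter.1 hi).2
      refine hne (((hQ l).lt_iff_rank hadj).symm.trans ?_)
      exact hagree l (l i) (List.mem_ofFn.2 ⟨i, rfl⟩) hadj
    have hrec : ∀ u, (cnt (Q l) u σ : ℝ) ≤ recordBound n k c := by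
      intro u
      by_contra! hlt
      exact hσ (mem_biUnion.2 ⟨u, mem_univ u, mem_filter.2 ⟨mem_univ σ, hlt⟩⟩)
    have hsum : (∑ u, (cnt (Q l) u σ : ℝ)) ≤ n * recordBound n k c := by
      refine (sum_le_card_nsmul _ _ _ fun u _ => hrec u).trans (le_of_eq ?_)
      rw [card_univ, Fintype.card_fin, nsmul_eq_mul]
    have hle : (q : ℝ) ≤ sampleSize n +
        ((misoriented G P (rank (Q l))).card + ∑ u, (cnt (Q l) u σ : ℝ)) := by
      rw [List.length_ofFn] at hq
      exact_mod_cast hq.trans (Nat.add_le_add_left (card_justifiedQueries_le σ) _)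
    show (q : ℝ) ≤ _
    linarith
  · have hprod : ((univ.filter fun ω : (Fin (sampleSize n) → Fin n × Fin n) ×
        Equiv.Perm (Fin n) => ω.2 ∈ bad₂ (Q ω.1)).card : ℝ) ≤
        Fintype.card (Fin (sampleSize n) → Fin n × Fin n) *
          ((n : ℝ) ^ (-(c + 1)) * Fintype.card (Equiv.Perm (Fin n))) := by
      have : (univ.filter fun ω : (Fin (sampleSize n) → Fin n × Fin n) ×
          Equiv.Perm (Fin n) => ω.2 ∈ bad₂ (Q ω.1)).card = ∑ l, (bad₂ (Q l)).card := by
        rw [card_filter, Fintype.sum_prod_type]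
        refine sum_congr rfl fun l _ => ?_
        rw [← card_filter]
        refine congrArg card ?_
        ext
        simp only [mem_filter, mem_univ, true_and]
      rw [this, Nat.cast_sum]
      refine (sum_le_card_nsmul _ _ _ fun l _ => hcard₂ (Q l)).trans (le_of_eq ?_)
      rw [card_univ, nsmul_eq_mul]
    have hunion := card_union_le (bad₁ ×ˢ (univ : Finset (Equiv.Perm (Fin n))))
      (univ.filter fun ω => ω.2 ∈ bad₂ (Q ω.1))
    rw [card_product, card_univ] at hunion
    have hunion' := (Nat.cast_le (α := ℝ)).2 hunion
    push_cast at hunion'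
    have h1 := mul_le_mul_of_nonneg_right hcard₁
      (Nat.cast_nonneg (Fintype.card (Equiv.Perm (Fin n))) : (0 : ℝ) ≤ _)
    have h2 := mul_le_mul_of_nonneg_right (two_mul_rpow_le (c := c) hn)
      (by positivity : (0 : ℝ) ≤ (Fintype.card (Fin (sampleSize n) → Fin n × Fin n) : ℝ) *
        Fintype.card (Equiv.Perm (Fin n)))
    rw [Fintype.card_prod, Nat.cast_mul]
    linarith

end Main
end PosetSorting

open PosetSorting in
theorem theorem4 :
    ∃ d : ℕ, ∀ c : ℝ, 0 < c →
      ∃ (C : ℝ) (A : (n : ℕ) → (G : SimpleGraph (Fin n)) → QueryAlg G),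
        ∀ (n k : ℕ) (G : SimpleGraph (Fin n)) (P : PartialOrder (Fin n)),
          IsWidth P k → IsInducedBy P G → EdgesComparable G P →
          1 - ENNReal.ofReal ((n : ℝ) ^ (-c)) ≤
            ((A n G).run P).toOuterMeasure
              {r : PartialOrder (Fin n) × ℕ | r.1 = P ∧
                (r.2 : ℝ) ≤ C * ((n : ℝ) * k + (n : ℝ) ^ (3 / 2 : ℝ)) *
                  Real.log ((n : ℝ) * k + (n : ℝ) ^ (3 / 2 : ℝ)) ^ d} := by
  refine ⟨1, fun c hc => ⟨12 + 3 * c, fun n G => if hn : n = 0 then .output (pick Set.univ)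
    else sortingAlg n hn G, fun n k G P hk hind hcomp => ?_⟩⟩
  dsimp only
  rcases Nat.lt_or_ge n 2 with hn | hn
  · interval_cases n
    -- For `n = 0`, both `0 ^ (-c)` and the query bound are `0`: no query and no failure is allowed.
    · have hP : pick Set.univ = P := PartialOrder.ext fun x => x.elim0
      rw [dif_pos rfl, QueryAlg.run, PMF.toOuterMeasure_pure_apply, if_pos]
      · exact tsub_le_self
      · exact ⟨hP, by simp⟩
    -- For `n = 1`, the required probability is `0`.
    · simp
  · rw [dif_neg (by omega)]
    refine (le_run_sortingAlg hn hc hk ⟨hind, hcomp⟩).trans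
      (MeasureTheory.OuterMeasure.mono _ fun r hr => ⟨hr.1, hr.2.trans (query_bound_le hn hc k)⟩)
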